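/- Let $W=(W_u)_{u\ge 0}$ be a standard Wiener process on a probability space $(\Omega,\mathcal F,\mathbf P)$, and let $S_0>0$ (initial asset price) and $K\ge 0$ (strike) be real numbers. For a volatility parameter $\widehat\sigma\in\mathbb R$ put $$\widehat\eta_1=\int_0^1\exp\Big\{\widehat\sigma W_u-\frac{\widehat\sigma^2}{2}u\Big\}\,du,\qquad \widehat C_0=\mathbf E\,(S_0\widehat\eta_1-K)_+ ,$$ where $x_+=\max(x,0)$. Then for every $\widehat\sigma$ the integral defining $\widehat\eta_1$ exists almost surely, $\widehat\eta_1$ and $(S_0\widehat\eta_1-K)_+$ are integrable random variables, and, as $\widehat\sigma\to+\infty$, $$\widehat\eta_1\longrightarrow 0\ \text{ in probability}\qquad\text{and}\qquad \widehat C_0\longrightarrow S_0 .$$ -/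

import Mathlib

open MeasureTheory ProbabilityTheory Filter Topology
open scoped NNReal

/-- The exponential martingale `exp (s W_u - s² u / 2)` of the process `W` with volatility `s`,
at a time `u`, which is only ever taken in `[0, 1]`
(so that `u.toNNReal` is `u` itself, as a time in `[0, ∞)`). -/
noncomputable def rhoHat {Ω : Type*} (W : ℝ≥0 → Ω → ℝ) (s : ℝ) (u : ℝ) (ω : Ω) : ℝ :=
  Real.exp (s * W u.toNNReal ω - s ^ 2 / 2 * u)

/-- The random variable `∫₀¹ exp (s W_u - s² u / 2) du`. -/
noncomputable def etaHat {Ω : Type*} (W : ℝ≥0 → Ω → ℝ) (s : ℝ) (ω : Ω) : ℝ :=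
  ∫ u in (0 : ℝ)..1, rhoHat W s u ω

/-- The payoff `(S₀ η - K)₊` of the Asian call option with strike `K` and initial asset price `S₀`,
under volatility `s`. -/
noncomputable def payoffHat {Ω : Type*} (W : ℝ≥0 → Ω → ℝ) (S₀ K s : ℝ) (ω : Ω) : ℝ :=
  max (S₀ * etaHat W s ω - K) 0

/-- The option price `E (S₀ η - K)₊` under volatility `s`. -/
noncomputable def priceHat {Ω : Type*} [MeasurableSpace Ω] (P : Measure Ω)
    (W : ℝ≥0 → Ω → ℝ) (S₀ K s : ℝ) : ℝ :=
  ∫ ω, payoffHat W S₀ K s ω ∂P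

/-! Write `η` for `etaHat`. Since `(S₀ η - K)₊ = S₀ η - S₀ min(η, K/S₀)` and `E η = 1`, both limits
reduce to `E min(η, c) → 0` for fixed `c ≥ 0`; convergence in probability is then Markov's
inequality with `c = ε`. To prove the reduced claim, split the time integral at a small `δ`. The
part over `[0, δ]` has mean `δ` for every volatility. On `[δ, 1]` the drift `-s² u / 2` beats `s
W_u` along each continuous path, and truncation at `c` permits dominated convergence. -/

/-- A process whose coordinates are a.e. measurable and whose paths are almost surely continuous
is indistinguishable from a process with measurable coordinates and continuous paths. -/
lemma exists_measurable_continuous_indistinguishable {Ω : Type*} [MeasurableSpace Ω]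
    {P : Measure Ω} {W : ℝ≥0 → Ω → ℝ} (hm : ∀ t, AEMeasurable (W t) P)
    (hc : ∀ᵐ ω ∂P, Continuous (W · ω)) :
    ∃ V : ℝ≥0 → Ω → ℝ, (∀ t, Measurable (V t)) ∧ (∀ ω, Continuous (V · ω)) ∧
      ∀ᵐ ω ∂P, ∀ t, W t ω = V t ω := by
  classical
  let q := TopologicalSpace.denseSeq ℝ≥0
  have hgood : ∀ᵐ ω ∂P, Continuous (W · ω) ∧ ∀ n, W (q n) ω = (hm (q n)).mk _ ω :=
    hc.and (ae_all_iff.2 fun n => (hm (q n)).ae_eq_mk)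
  obtain ⟨N, hN, hNm, hN0⟩ := exists_measurable_superset_of_null (ae_iff.1 hgood)
  set G := Nᶜ
  have hGm : MeasurableSet G := hNm.compl
  have hG : ∀ ω ∈ G, Continuous (W · ω) ∧ ∀ n, W (q n) ω = (hm (q n)).mk _ ω :=
    fun ω hω => not_not.1 fun h => hω (hN h)
  have hGsub : ∀ᵐ ω ∂P, ω ∈ G := measure_eq_zero_iff_ae_notMem.1 hN0
  -- Setting bad paths to zero keeps continuity, so measurability at the dense times passes to every
  -- time by pointwise limits.
  let V : ℝ≥0 → Ω → ℝ := fun t => G.indicator (W t)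
  have hVc : ∀ ω, Continuous (V · ω) := by
    intro ω
    by_cases h : ω ∈ G
    · simpa [V, h] using (hG ω h).1
    · simpa [V, h] using continuous_const
  have hVq : ∀ n, Measurable (V (q n)) := by
    intro n
    have : V (q n) = G.indicator ((hm (q n)).mk _) :=
      Set.indicator_congr fun ω hω => (hG ω hω).2 n
    rw [this]
    exact (hm (q n)).measurable_mk.indicator hGm
  refine ⟨V, fun t => ?_, hVc, ?_⟩
  · obtain ⟨x, hx, hxt⟩ := mem_closure_iff_seq_limit.1
      (TopologicalSpace.denseRange_denseSeq ℝ≥0 t)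
    refine measurable_of_tendsto_metrizable (f := fun n => V (x n)) (fun n => ?_) ?_
    · obtain ⟨k, hk⟩ := hx n
      rw [← hk]
      exact hVq k
    · exact tendsto_pi_nhds.2 fun ω => ((hVc ω).tendsto t).comp hxt
  · filter_upwards [hGsub] with ω h t
    simp [V, h]

section

variable {Ω : Type*} {V : ℝ≥0 → Ω → ℝ}

lemma rhoHat_nonneg (V : ℝ≥0 → Ω → ℝ) (s u : ℝ) (ω : Ω) : 0 ≤ rhoHat V s u ω :=
  (Real.exp_pos _).le

lemma continuous_rhoHat {ω : Ω} (hc : Continuous (V · ω)) (s : ℝ) :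
    Continuous (fun u => rhoHat V s u ω) := by
  unfold rhoHat
  have : Continuous fun u : ℝ => V u.toNNReal ω := hc.comp continuous_real_toNNReal
  fun_prop

lemma etaHat_nonneg (V : ℝ≥0 → Ω → ℝ) (s : ℝ) (ω : Ω) : 0 ≤ etaHat V s ω :=
  intervalIntegral.integral_nonneg zero_le_one fun u _ => rhoHat_nonneg V s u ω

/-- Away from time `0`, the exponential martingale of a continuous path tends to `0` uniformly
as the volatility grows. -/
lemma tendsto_integral_rhoHat {ω : Ω} (hc : Continuous (V · ω)) {δ : ℝ} (hδ : 0 < δ)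
    (hδ1 : δ ≤ 1) :
    Tendsto (fun s : ℝ => ∫ u in δ..1, rhoHat V s u ω) atTop (𝓝 0) := by
  have hcont : Continuous fun u : ℝ => V u.toNNReal ω := hc.comp continuous_real_toNNReal
  obtain ⟨M, hM⟩ := (isCompact_Icc (a := δ) (b := 1)).bddAbove_image hcont.continuousOn
  -- For `s ≥ 0` and `u ≥ δ`, the exponent is at most `s M - s² δ / 2`.
  have hexp : Tendsto (fun s : ℝ => Real.exp (s * (M - s * (δ / 2))) * |1 - δ|) atTop (𝓝 0) := by
    have h1 : Tendsto (fun s : ℝ => M - s * (δ / 2)) atTop atBot :=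
      tendsto_atBot_add_const_left _ M
        (tendsto_neg_atTop_atBot.comp (tendsto_id.atTop_mul_const (half_pos hδ)))
    simpa using (Real.tendsto_exp_atBot.comp (tendsto_id.atTop_mul_atBot₀ h1)).mul_const |1 - δ|
  refine squeeze_zero_norm' ?_ hexp
  filter_upwards [eventually_ge_atTop 0] with s hs
  refine intervalIntegral.norm_integral_le_of_norm_le_const fun u hu => ?_
  rw [Set.uIoc_of_le hδ1] at hu
  rw [Real.norm_of_nonneg (rhoHat_nonneg V s u ω)]
  refine Real.exp_le_exp.2 ?_
  have h1 : V u.toNNReal ω ≤ M := hM ⟨u, ⟨hu.1.le, hu.2⟩, rfl⟩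
  have h2 := mul_le_mul_of_nonneg_left h1 hs
  have h3 := mul_le_mul_of_nonneg_left hu.1.le (sq_nonneg s)
  nlinarith

variable [MeasurableSpace Ω] {P : Measure Ω}

lemma measurable_uncurry_rhoHat (hm : ∀ t, Measurable (V t)) (hc : ∀ ω, Continuous (V · ω))
    (s : ℝ) : Measurable (fun p : ℝ × Ω => rhoHat V s p.1 p.2) := by
  have h : Measurable (Function.uncurry V) :=
    (stronglyMeasurable_uncurry_of_continuous_of_stronglyMeasurable hc
      fun t => (hm t).stronglyMeasurable).measurable
  have h' : Measurable fun p : ℝ × Ω => V p.1.toNNReal p.2 :=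
    h.comp (measurable_fst.real_toNNReal.prodMk measurable_snd)
  exact Real.measurable_exp.comp
    ((h'.const_mul s).sub (measurable_fst.const_mul (s ^ 2 / 2)))

lemma integrable_rhoHat (hlaw : ∀ t, HasLaw (V t) (gaussianReal 0 t) P) (s u : ℝ) :
    Integrable (rhoHat V s u) P := by
  have h : Integrable (fun ω => Real.exp (s * V u.toNNReal ω)) P := by
    have := integrable_exp_mul_gaussianReal (μ := 0) (v := u.toNNReal) s
    rw [← (hlaw _).map_eq] at this
    exact this.comp_aemeasurable (hlaw _).aemeasurable
  unfold rhoHat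
  simp only [Real.exp_sub]
  exact h.div_const _

/-- The Gaussian moment generating function `exp (s² u / 2)` cancels the drift. -/
lemma integral_rhoHat (hlaw : ∀ t, HasLaw (V t) (gaussianReal 0 t) P) (s : ℝ) {u : ℝ}
    (hu : 0 ≤ u) : ∫ ω, rhoHat V s u ω ∂P = 1 := by
  have h := mgf_gaussianReal (hlaw u.toNNReal).map_eq s
  simp only [mgf, Real.coe_toNNReal u hu] at h
  simp only [rhoHat, Real.exp_sub, integral_div, h]
  rw [← Real.exp_sub, Real.exp_eq_one_iff]
  ring

variable [IsProbabilityMeasure P]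

lemma integrable_prod_rhoHat (hm : ∀ t, Measurable (V t)) (hc : ∀ ω, Continuous (V · ω))
    (hlaw : ∀ t, HasLaw (V t) (gaussianReal 0 t) P) (s : ℝ) {a b : ℝ} (ha : 0 ≤ a) :
    Integrable (fun p : ℝ × Ω => rhoHat V s p.1 p.2)
      ((volume.restrict (Set.Ioc a b)).prod P) := by
  refine (integrable_prod_iff (measurable_uncurry_rhoHat hm hc s).aestronglyMeasurable).2
    ⟨ae_of_all _ fun u => integrable_rhoHat hlaw s u, ?_⟩
  refine (integrable_const (1 : ℝ)).congr ?_
  filter_upwards [ae_restrict_mem measurableSet_Ioc] with u hu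
  simp_rw [Real.norm_of_nonneg (rhoHat_nonneg V s u _)]
  exact (integral_rhoHat hlaw s (ha.trans hu.1.le)).symm

lemma integrable_intervalIntegral_rhoHat (hm : ∀ t, Measurable (V t))
    (hc : ∀ ω, Continuous (V · ω)) (hlaw : ∀ t, HasLaw (V t) (gaussianReal 0 t) P) (s : ℝ)
    {a b : ℝ} (ha : 0 ≤ a) (hab : a ≤ b) :
    Integrable (fun ω => ∫ u in a..b, rhoHat V s u ω) P := by
  simp_rw [intervalIntegral.integral_of_le hab]
  exact (integrable_prod_rhoHat hm hc hlaw s ha).integral_prod_right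

lemma integral_intervalIntegral_rhoHat (hm : ∀ t, Measurable (V t))
    (hc : ∀ ω, Continuous (V · ω)) (hlaw : ∀ t, HasLaw (V t) (gaussianReal 0 t) P) (s : ℝ)
    {a b : ℝ} (ha : 0 ≤ a) (hab : a ≤ b) :
    ∫ ω, (∫ u in a..b, rhoHat V s u ω) ∂P = b - a := by
  simp_rw [intervalIntegral.integral_of_le hab]
  rw [← integral_integral_swap (integrable_prod_rhoHat hm hc hlaw s ha),
    setIntegral_congr_fun measurableSet_Ioc
      fun u hu => integral_rhoHat hlaw s (ha.trans hu.1.le)]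
  simp [hab]

lemma tendsto_integral_min_etaHat (hm : ∀ t, Measurable (V t)) (hc : ∀ ω, Continuous (V · ω))
    (hlaw : ∀ t, HasLaw (V t) (gaussianReal 0 t) P) {c : ℝ} (hc0 : 0 ≤ c) :
    Tendsto (fun s : ℝ => ∫ ω, min (etaHat V s ω) c ∂P) atTop (𝓝 0) := by
  have htail : ∀ δ : ℝ, 0 < δ → δ ≤ 1 →
      Tendsto (fun s : ℝ => ∫ ω, min (∫ u in δ..1, rhoHat V s u ω) c ∂P) atTop (𝓝 0) := by
    intro δ hδ hδ1
    rw [← integral_zero Ω ℝ (μ := P)]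
    refine tendsto_integral_filter_of_dominated_convergence (fun _ => c)
      (Eventually.of_forall fun s => ((integrable_intervalIntegral_rhoHat hm hc hlaw s hδ.le
        hδ1).inf (integrable_const c)).aestronglyMeasurable)
      (Eventually.of_forall fun s => ae_of_all _ fun ω => ?_) (integrable_const c)
      (ae_of_all _ fun ω => ?_)
    · rw [Real.norm_of_nonneg (le_min (intervalIntegral.integral_nonneg hδ1
        fun u _ => rhoHat_nonneg V s u ω) hc0)]
      exact min_le_right _ _
    · simpa [hc0] using (tendsto_integral_rhoHat (hc ω) hδ hδ1).min
        (tendsto_const_nhds (x := c))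
  rw [Metric.tendsto_nhds]
  intro ε hε
  -- The early part then costs at most `ε / 2`, uniformly in `s`.
  set δ := min (ε / 2) 1
  have hδ : 0 < δ := lt_min (half_pos hε) one_pos
  have hδ1 : δ ≤ 1 := min_le_right _ _
  filter_upwards [(htail δ hδ hδ1).eventually_lt_const (half_pos hε)] with s hs
  have hnn : 0 ≤ ∫ ω, min (etaHat V s ω) c ∂P :=
    integral_nonneg fun ω => le_min (etaHat_nonneg V s ω) hc0
  have hint : Integrable (fun ω => min (∫ u in δ..1, rhoHat V s u ω) c) P :=
    (integrable_intervalIntegral_rhoHat hm hc hlaw s hδ.le hδ1).inf (integrable_const c)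
  have hint0 := integrable_intervalIntegral_rhoHat hm hc hlaw s le_rfl hδ.le
  have hle : ∫ ω, min (etaHat V s ω) c ∂P ≤
      ∫ ω, ((∫ u in (0 : ℝ)..δ, rhoHat V s u ω) + min (∫ u in δ..1, rhoHat V s u ω) c) ∂P := by
    refine integral_mono ((integrable_intervalIntegral_rhoHat hm hc hlaw s le_rfl
      zero_le_one).inf (integrable_const c)) (hint0.add hint)
      fun ω => ?_
    have hsplit := intervalIntegral.integral_add_adjacent_intervals
      ((continuous_rhoHat (hc ω) s).intervalIntegrable 0 δ)
      ((continuous_rhoHat (hc ω) s).intervalIntegrable (μ := volume) δ 1)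
    have h0 : 0 ≤ ∫ u in (0 : ℝ)..δ, rhoHat V s u ω :=
      intervalIntegral.integral_nonneg hδ.le fun u _ => rhoHat_nonneg V s u ω
    simp only [etaHat, ← hsplit]
    -- For `a ≥ 0`, `min (a + b) c ≤ a + min b c`: only the late part needs truncating.
    rw [← min_add_add_left]
    exact min_le_min_left _ (by linarith)
  rw [integral_add hint0 hint,
    integral_intervalIntegral_rhoHat hm hc hlaw s le_rfl hδ.le] at hle
  rw [Real.dist_eq, sub_zero, abs_of_nonneg hnn]
  have : δ ≤ ε / 2 := min_le_left _ _
  linarith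

end

theorem mainTheorem2 {Ω : Type*} [MeasurableSpace Ω] (P : Measure Ω) [IsProbabilityMeasure P]
    (W : ℝ≥0 → Ω → ℝ) (hW : IsBrownianReal W P)
    (S₀ K : ℝ) (hS₀ : 0 < S₀) (hK : 0 ≤ K) :
    (∀ s : ℝ, ∀ᵐ ω ∂P, IntervalIntegrable (fun u => rhoHat W s u ω) volume 0 1) ∧
    (∀ s : ℝ, Integrable (etaHat W s) P) ∧
    (∀ s : ℝ, Integrable (payoffHat W S₀ K s) P) ∧
    TendstoInMeasure P (fun s : ℝ => etaHat W s) atTop (fun _ => (0 : ℝ)) ∧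
    Tendsto (fun s : ℝ => priceHat P W S₀ K s) atTop (𝓝 S₀) := by
  obtain ⟨V, hm, hc, hWV⟩ := exists_measurable_continuous_indistinguishable hW.aemeasurable hW.cont
  have hlaw : ∀ t, HasLaw (V t) (gaussianReal 0 t) P := fun t =>
    (hW.hasLaw_eval t).congr (hWV.mono fun ω h => (h t).symm)
  have hη : ∀ s, etaHat V s =ᵐ[P] etaHat W s := fun s => by
    filter_upwards [hWV] with ω h
    simp only [etaHat, rhoHat, h]
  have hηV : ∀ s, Integrable (etaHat V s) P := fun s =>
    integrable_intervalIntegral_rhoHat hm hc hlaw s le_rfl zero_le_one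
  have hηW : ∀ s, Integrable (etaHat W s) P := fun s => (hηV s).congr (hη s)
  refine ⟨fun s => ?_, hηW, fun s => ?_, ?_, ?_⟩
  · filter_upwards [hW.cont] with ω h
    exact (continuous_rhoHat h s).intervalIntegrable 0 1
  · exact (((hηW s).const_mul S₀).sub (integrable_const K)).pos_part
  · refine TendstoInMeasure.congr_left hη ?_
    rw [tendstoInMeasure_iff_measureReal_norm]
    intro ε hε
    have hlim := (tendsto_integral_min_etaHat hm hc hlaw hε.le).const_mul ε⁻¹
    rw [mul_zero] at hlim
    refine squeeze_zero (fun _ => measureReal_nonneg) (fun s => ?_) hlim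
    -- Truncating at the threshold loses nothing: `min η ε ≥ ε` exactly when `η ≥ ε`.
    have hmarkov := mul_meas_ge_le_integral_of_nonneg (μ := P)
      (ae_of_all _ fun ω => le_min (etaHat_nonneg V s ω) hε.le)
      ((hηV s).inf (integrable_const ε)) ε
    rw [le_inv_mul_iff₀ hε]
    simpa [abs_of_nonneg (etaHat_nonneg V s _)] using hmarkov
  · have hprice : ∀ s, priceHat P W S₀ K s =
        S₀ - S₀ * ∫ ω, min (etaHat V s ω) (K / S₀) ∂P := by
      intro s
      have h1 : ∫ ω, etaHat V s ω ∂P = 1 := by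
        simpa [etaHat] using integral_intervalIntegral_rhoHat hm hc hlaw s le_rfl zero_le_one
      have h2 : priceHat P W S₀ K s =
          ∫ ω, (S₀ * etaHat V s ω - S₀ * min (etaHat V s ω) (K / S₀)) ∂P := by
        refine integral_congr_ae ?_
        filter_upwards [hη s] with ω h
        rw [payoffHat, ← h, mul_min_of_nonneg _ _ hS₀.le, mul_div_cancel₀ _ hS₀.ne']
        rcases le_total (S₀ * etaHat V s ω) K with h | h
        · rw [max_eq_right (by linarith), min_eq_left h, sub_self]
        · rw [max_eq_left (by linarith), min_eq_right h]
      have h3 : Integrable (fun ω => min (etaHat V s ω) (K / S₀)) P :=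
        (hηV s).inf (integrable_const _)
      rw [h2, integral_sub ((hηV s).const_mul S₀) (h3.const_mul S₀), integral_const_mul,
        integral_const_mul, h1, mul_one]
    simp_rw [hprice]
    simpa using ((tendsto_integral_min_etaHat hm hc hlaw (div_nonneg hK hS₀.le)).const_mul
      S₀).const_sub S₀
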